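/- Let $n\ge 1$, let $M$ be a nonsingular $n\times n$ integral matrix, put $m=|\det M|$, and let $d_{k}(M)$ denote the $k$-th determinantal divisor of $M$, that is, the greatest common divisor of all $k\times k$ minors of $M$, with $d_0(M)=1$. For an integral vector $v$, $\gcd(v)$ denotes the greatest common divisor of its coordinates. Let $a_1,a_2\in\mathbb Z^n$ be such that their classes modulo $M\mathbb Z^n$ are nonzero and generate the group $\mathbb Z^n/M\mathbb Z^n$, and let $A=\{a_1,a_2\}\subseteq \mathbb Z^n/M\mathbb Z^n$. The digraph $G(M;A)$ has vertex set $\mathbb Z^n/M\mathbb Z^n$ and an arc from $u$ to $v$ iff $v-u\in A$; the graph $G(M;\pm A)$ has the same vertex set, and $u,v$ are adjacent iff $v-u\in\{\pm a_1,\pm a_2\}$. A digraph is a circulant if it is isomorphic, for some integer $r\ge 1$ and some $B\subseteq(\mathbb Z/r\mathbb Z)\setminus\{0\}$, to the digraph on $\mathbb Z/r\mathbb Z$ with an arc from $u$ to $v$ iff $v-u\in B$; a graph is a circulant if it is isomorphic, for some integer $r\ge 1$ and some $B\subseteq(\mathbb Z/r\mathbb Z)\setminus\{0\}$ with $B=-B$,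 to the graph on $\mathbb Z/r\mathbb Z$ in which $u,v$ are adjacent iff $v-u\in B$. Consider the conditions (a) $d_{n-1}(M)=1$; (b) $d_{n-1}(M)=2$ and $m=2\gcd\bigl(m,\gcd(mM^{-1}(a_1-a_2))\bigr)$; (c) $d_{n-1}(M)=2$ and $m=2\gcd\bigl(m,\gcd(mM^{-1}(a_1+a_2))\bigr)$. Then the digraph $G(M;A)$ is a circulant if and only if (a) or (b) holds, and the graph $G(M;\pm A)$ is a circulant if and only if (a), (b) or (c) holds. -/

import Mathlib

open scoped Matrix

/-- `gcd(a₁, …, aₙ)` of the coordinates of an integral vector, as a natural number. -/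
def vecGcd {n : ℕ} (a : Fin n → ℤ) : ℕ :=
  Finset.univ.gcd fun i => (a i).natAbs

/-- The `k`-th determinantal divisor of an integral matrix: the greatest common divisor of all its
`k × k` minors. A choice of `k` rows (columns) is an increasing map `Fin k ↪o Fin n`. For `k = 0`
the only minor is the empty determinant `1`, so that the zeroth determinantal divisor is `1`. -/
noncomputable def determinantalDivisor {n : ℕ} (M : Matrix (Fin n) (Fin n) ℤ) (k : ℕ) : ℕ :=
  Finset.univ.gcd fun p : (Fin k ↪o Fin n) × (Fin k ↪o Fin n) => (M.submatrix p.1 p.2).det.natAbs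

/-- The integral vector `m M⁻¹ a`, where `m = |det M|`; `scaledInv_eq` shows that it is this. -/
def scaledInv {n : ℕ} (M : Matrix (Fin n) (Fin n) ℤ) (a : Fin n → ℤ) : Fin n → ℤ :=
  M.det.sign • (M.adjugate *ᵥ a)

theorem scaledInv_eq {n : ℕ} (M : Matrix (Fin n) (Fin n) ℤ) (hM : M.det ≠ 0) (a : Fin n → ℤ) :
    (fun i => (scaledInv M a i : ℚ)) =
      (M.det.natAbs : ℚ) • ((M.map (Int.cast : ℤ → ℚ))⁻¹ *ᵥ fun i => (a i : ℚ)) := by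
  have hdet : (M.map (Int.cast : ℤ → ℚ)).det = (M.det : ℚ) :=
    ((Int.castRingHom ℚ).map_det M).symm
  have hadj : (M.map (Int.cast : ℤ → ℚ)).adjugate = M.adjugate.map (Int.cast : ℤ → ℚ) :=
    ((Int.castRingHom ℚ).map_adjugate M).symm
  have h0 : (M.det : ℚ) ≠ 0 := by exact_mod_cast hM
  have habs : (M.det.natAbs : ℚ) = (M.det.sign : ℚ) * (M.det : ℚ) := by
    rw [← Int.cast_mul, Int.sign_mul_self_eq_natAbs, Int.cast_natCast]
  funext i
  rw [Matrix.inv_def, hdet, hadj, Ring.inverse_eq_inv', habs, Matrix.smul_mulVec, smul_smul,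
    mul_assoc, mul_inv_cancel₀ h0, mul_one]
  simp [scaledInv, Matrix.mulVec, dotProduct]

/-- The lattice `M ℤⁿ`. -/
abbrev matLattice {n : ℕ} (M : Matrix (Fin n) (Fin n) ℤ) : Submodule ℤ (Fin n → ℤ) :=
  LinearMap.range M.mulVecLin

/-- The group `ℤⁿ / M ℤⁿ` of integral vectors modulo `M`. -/
abbrev VecMod {n : ℕ} (M : Matrix (Fin n) (Fin n) ℤ) : Type :=
  (Fin n → ℤ) ⧸ matLattice M

/-- The class modulo `M` of an integral vector. -/
abbrev VecMod.mk {n : ℕ} (M : Matrix (Fin n) (Fin n) ℤ) (a : Fin n → ℤ) : VecMod M :=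
  Submodule.Quotient.mk a

/-- The Cayley digraph of an additive group: an arc from `u` to `v` iff `-u + v ∈ A`. -/
def cayleyDigraph {Γ : Type*} [AddGroup Γ] (A : Set Γ) : Digraph Γ where
  Adj u v := -u + v ∈ A

/-- The multidimensional circulant digraph `G(M; A)`. -/
def multiCirculantDigraph {n : ℕ} (M : Matrix (Fin n) (Fin n) ℤ) (A : Set (VecMod M)) :
    Digraph (VecMod M) :=
  cayleyDigraph A

/-- The multidimensional circulant graph `G(M; ±A)`: `u` and `v` are adjacent iff they are distinct
and `u - v ∈ ±A`. Mathlib's `circulantGraph` is defined over any group, not only a cyclic one, and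
closes its set of jumps under negation. -/
def multiCirculantGraph {n : ℕ} (M : Matrix (Fin n) (Fin n) ℤ) (A : Set (VecMod M)) :
    SimpleGraph (VecMod M) :=
  SimpleGraph.circulantGraph A

/-- A digraph is a circulant if it is isomorphic to the circulant digraph `G(m; B)` for some positive
integer `m` and some `B ⊆ (ℤ/mℤ) \ {0}`. -/
def Digraph.IsCirculant {V : Type*} (G : Digraph V) : Prop :=
  ∃ m : ℕ, 0 < m ∧ ∃ B : Set (ZMod m), (0 : ZMod m) ∉ B ∧
    Nonempty (G.Adj ≃r (cayleyDigraph B).Adj)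

/-- A graph is a circulant if it is isomorphic to the circulant graph `G(m; B)` for some positive
integer `m` and some `B ⊆ (ℤ/mℤ) \ {0}` with `B = -B`. -/
def SimpleGraph.IsCirculant {V : Type*} (G : SimpleGraph V) : Prop :=
  ∃ m : ℕ, 0 < m ∧ ∃ B : Set (ZMod m), (0 : ZMod m) ∉ B ∧ (∀ b ∈ B, -b ∈ B) ∧
    Nonempty (G ≃g SimpleGraph.circulantGraph B)

/-! ### Bijections with locally constant steps, and the directed case. -/

section Rigidity

variable {Δ Γ : Type*} [AddCommGroup Δ] [AddCommGroup Γ]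

/-! Put Γ = ℤⁿ/Mℤⁿ. Everything reduces to a statement about a finite abelian group with two nonzero
generators: the digraph is a circulant iff Γ is cyclic or a₁ - a₂ has order 2, and the graph iff
moreover a₁ + a₂ may have order 2.

For necessity, let ψ be the bijection from a cyclic group given by an isomorphism. If crossing one
arc never changes the step of ψ along another, then ψ is affine, so Γ is a quotient of a cyclic
group. Constancy is read off from squares v, v + b, v + b + c, v + c: it can fail only through short
relations between the generators. When Γ is not cyclic these reduce to 2a₁ = 2a₂ (and 2a₁ = -2a₂ for
graphs), apart from coincidences due to elements of order dividing 4, treated by hand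
(`isAddCyclic_of_digraph_equiv`, `isAddCyclic_of_graph_equiv_zmod`).

For sufficiency, if a₁ - a₂ is an involution, Γ modulo it is cyclic of some order e, and adjacency
depends only on classes there. ℤ/2e → ℤ/e has fibres of the same size, so a fibre-preserving
bijection is an isomorphism (`exists_equiv_zmod_of_hom`).

The translation to matrices is that Γ has order m and exponent m / d_{n-1}(M)
(`exponent_mul_determinantalDivisor`), together with the order of the class of a vector read from m
M⁻¹ a. -/

theorem exists_addMonoidHom_of_step_const (ψ : Δ → Γ) {B : Set Δ}
    (hB : AddSubgroup.closure B = ⊤)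
    (h : ∀ v, ∀ b ∈ B, ∀ c ∈ B, ψ (v + b + c) - ψ (v + b) = ψ (v + c) - ψ v) :
    ∃ f : Δ →+ Γ, ∀ v, ψ v = f v + ψ 0 := by
  -- The hypothesis extends along words in `B`, first in the base point and then, in `add`, in the
  -- increment.
  have step : ∀ c ∈ B, ∀ w v, ψ (v + w + c) - ψ (v + w) = ψ (v + c) - ψ v := by
    intro c hc w
    have hw : w ∈ AddSubgroup.closure B := hB ▸ AddSubgroup.mem_top w
    induction hw using AddSubgroup.closure_induction with
    | mem b hb => exact fun v => h v b hb c hc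
    | zero => simp
    | add x y _ _ hx hy =>
      intro v
      rw [← add_assoc, hy (v + x), hx v]
    | neg x _ hx =>
      intro v
      have := hx (v + -x)
      rw [neg_add_cancel_right] at this
      exact this.symm
  have add : ∀ w v, ψ (v + w) - ψ v = ψ w - ψ 0 := by
    intro w
    have hw : w ∈ AddSubgroup.closure B := hB ▸ AddSubgroup.mem_top w
    induction hw using AddSubgroup.closure_induction with
    | mem b hb => intro v; simpa using step b hb v 0
    | zero => simp
    | add x y _ _ hx hy =>
      intro v
      have h1 := hy (v + x)
      have h2 := hx v
      have h3 := hy x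
      rw [← add_assoc]
      grind
    | neg x _ hx =>
      intro v
      have h1 := hx (v + -x)
      have h2 := hx (-x)
      rw [neg_add_cancel_right] at h1
      rw [neg_add_cancel] at h2
      grind
  refine ⟨AddMonoidHom.mk' (fun v => ψ v - ψ 0) fun v w => ?_, fun v => by simp⟩
  have := add w v
  grind

/-- Connectedness is transported: a path in Γ with steps in `S` pulls back to a path with steps in
`B`. -/
theorem closure_eq_top_of_steps (ψ : Δ ≃ Γ) {B : Set Δ} {S : Set Γ}
    (hS : AddSubgroup.closure S = ⊤)
    (h : ∀ v w, ψ w - ψ v ∈ S → w - v ∈ B) : AddSubgroup.closure B = ⊤ := by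
  have key : ∀ x u : Γ, ψ.symm (u + x) - ψ.symm u ∈ AddSubgroup.closure B := by
    intro x
    have hx : x ∈ AddSubgroup.closure S := hS ▸ AddSubgroup.mem_top x
    induction hx using AddSubgroup.closure_induction with
    | mem s hs => exact fun u => AddSubgroup.subset_closure (h _ _ (by simpa using hs))
    | zero => simp
    | add x y _ _ hx hy =>
      intro u
      have := add_mem (hy (u + x)) (hx u)
      rwa [sub_add_sub_cancel, add_assoc] at this
    | neg x _ hx =>
      intro u
      have := neg_mem (hx (u + -x))
      rwa [neg_add_cancel_right, neg_sub] at this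
  rw [eq_top_iff]
  intro w _
  simpa using key (ψ w - ψ 0) (ψ 0)

theorem isAddCyclic_of_step_const [IsAddCyclic Δ] (ψ : Δ ≃ Γ) {B : Set Δ} {S : Set Γ}
    (hS : AddSubgroup.closure S = ⊤) (hBS : ∀ v w, ψ w - ψ v ∈ S → w - v ∈ B)
    (h : ∀ v, ∀ b ∈ B, ∀ c ∈ B, ψ (v + b + c) - ψ (v + b) = ψ (v + c) - ψ v) :
    IsAddCyclic Γ := by
  obtain ⟨f, hf⟩ := exists_addMonoidHom_of_step_const ψ (closure_eq_top_of_steps ψ hS hBS) h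
  refine isAddCyclic_of_surjective f fun x => ⟨ψ.symm (x + ψ 0), ?_⟩
  have := hf (ψ.symm (x + ψ 0))
  rw [Equiv.apply_symm_apply] at this
  exact (add_right_cancel this).symm

theorem isAddCyclic_of_closure_pair_of_zsmul {a₁ a₂ : Γ}
    (hgen : AddSubgroup.closure {a₁, a₂} = ⊤) (k : ℤ) (h : a₁ = k • a₂) : IsAddCyclic Γ := by
  refine ⟨a₂, fun x => ?_⟩
  have hx : x ∈ AddSubgroup.closure {a₁, a₂} := hgen ▸ AddSubgroup.mem_top x
  refine (AddSubgroup.closure_le (AddSubgroup.zmultiples a₂)).2 ?_ hx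
  rintro y (rfl | rfl)
  · exact h ▸ AddSubgroup.zsmul_mem_zmultiples _ _
  · exact AddSubgroup.mem_zmultiples _

/-- If the out-neighbourhoods `u + {a₁, a₂}` are preserved by a bijection from a cyclic group, the
only obstruction to cyclicity is a coincidence `2a₁ = 2a₂`. -/
theorem isAddCyclic_of_digraph_equiv [IsAddCyclic Δ] (ψ : Δ ≃ Γ) {B : Set Δ} {a₁ a₂ : Γ}
    (hgen : AddSubgroup.closure {a₁, a₂} = ⊤)
    (hψ : ∀ v w, w - v ∈ B ↔ ψ w - ψ v ∈ ({a₁, a₂} : Set Γ)) (h2 : a₁ + a₁ ≠ a₂ + a₂) :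
    IsAddCyclic Γ := by
  have hne : a₁ ≠ a₂ := by rintro rfl; exact h2 rfl
  have mem : ∀ v, ∀ b ∈ B, ψ (v + b) - ψ v = a₁ ∨ ψ (v + b) - ψ v = a₂ := by
    intro v b hb
    simpa using (hψ v (v + b)).1 (by simpa using hb)
  have inj : ∀ v b c, ψ (v + b) - ψ v = ψ (v + c) - ψ v → b = c := by
    intro v b c h
    simpa using h
  -- Both routes to v + b + c have the same total, and they start with different generators. The
  -- routes a₁ + a₁ and a₂ + a₂ are excluded by `h2`, so each route uses both generators.
  have key : ∀ v, ∀ b ∈ B, ∀ c ∈ B, b ≠ c → ψ (v + b + c) - ψ (v + b) = ψ (v + c) - ψ v := by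
    intro v b hb c hc hbc
    have h1 := mem v b hb
    have h2 := mem v c hc
    have h3 := mem (v + b) c hc
    have h4 := mem (v + c) b hb
    have h5 := mt (inj v b c) hbc
    rw [add_right_comm v c b] at h4
    grind
  refine isAddCyclic_of_step_const ψ hgen (fun v w => (hψ v w).2) fun v b hb c hc => ?_
  by_cases hbc : b = c
  · subst hbc
    -- Take the other out-neighbour v + d. By `key` the step of d is unchanged at v + b, which
    -- leaves for b only its old value.
    obtain ⟨x, hx, hxp⟩ : ∃ x ∈ ({a₁, a₂} : Set Γ), x ≠ ψ (v + b) - ψ v := by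
      by_cases h : a₁ = ψ (v + b) - ψ v
      · exact ⟨a₂, by simp, fun h' => hne (h.trans h'.symm)⟩
      · exact ⟨a₁, by simp, h⟩
    set d := ψ.symm (ψ v + x) - v with hd
    have hvd : ψ (v + d) - ψ v = x := by simp [hd]
    have hdB : d ∈ B := by
      have := (hψ v (v + d)).2 (hvd ▸ hx)
      simpa using this
    have hbd : b ≠ d := by rintro h; exact hxp (by rw [h, hvd])
    have h1 := key v b hb d hdB hbd
    have h2 := mem v b hb
    have h3 := mem (v + b) b hb
    have h4 := mt (inj (v + b) b d) hbd
    have h5 : x = a₁ ∨ x = a₂ := by simpa using hx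
    grind
  · exact key v b hb c hc hbc

end Rigidity

/-! ### The undirected case: bijections preserve antipodal pairs of neighbours. -/

section Antipodal

universe u

/-- The square-zero extension ℤ ⊕ Γ contains Γ additively. It lets the case analyses on relations
below be carried out by commutative ring arithmetic. -/
theorem exists_injective_addMonoidHom_commRing (Γ : Type u) [AddCommGroup Γ] :
    ∃ (R : Type u) (_ : CommRing R) (ι : Γ →+ R), Function.Injective ι := by
  let _ : Module ℤᵐᵒᵖ Γ :=
    Module.compHom Γ ((RingHom.id ℤ).fromOpposite fun _ _ => Commute.all _ _)
  have : IsCentralScalar ℤ Γ := ⟨fun _ _ => rfl⟩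
  exact ⟨TrivSqZeroExt ℤ Γ, inferInstance, TrivSqZeroExt.inrHom ℤ Γ,
    TrivSqZeroExt.inr_injective⟩

section Group

variable {Γ : Type*} [AddCommGroup Γ]
/-- The connection set `{±a₁, ±a₂}`. -/
def signedPair (a₁ a₂ : Γ) : Set Γ := {a₁, -a₁, a₂, -a₂}

theorem mem_signedPair {a₁ a₂ x : Γ} :
    x ∈ signedPair a₁ a₂ ↔ x = a₁ ∨ x = -a₁ ∨ x = a₂ ∨ x = -a₂ := by
  simp [signedPair]

theorem signedPair_comm (a₁ a₂ : Γ) : signedPair a₁ a₂ = signedPair a₂ a₁ := by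
  ext x
  simp only [mem_signedPair]
  tauto

theorem neg_mem_signedPair {a₁ a₂ x : Γ} (hx : x ∈ signedPair a₁ a₂) :
    -x ∈ signedPair a₁ a₂ := by
  rw [mem_signedPair] at *
  rcases hx with rfl | rfl | rfl | rfl <;> simp

/-- The relations between two generators that have to be excluded for the Cayley graph on
`{±p, ±q}` to have no accidental squares besides those coming from elements of order four. -/
structure NoShortRelations (p q : Γ) : Prop where
  ne : p ≠ q
  ne_neg : p ≠ -q
  ne_three : p ≠ q + q + q
  ne_neg_three : p ≠ -(q + q + q)
  three_ne : q ≠ p + p + p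
  neg_three_ne : q ≠ -(p + p + p)
  two_ne : p + p ≠ q + q
  two_ne_neg : p + p ≠ -(q + q)

theorem NoShortRelations.symm {p q : Γ} (h : NoShortRelations p q) : NoShortRelations q p := by
  obtain ⟨h1, h2, h3, h4, h5, h6, h7, h8⟩ := h
  exact ⟨h1.symm, fun e => h2 (by rw [e, neg_neg]), h5, h6, h3, h4, h7.symm,
    fun e => h8 (by rw [e, neg_neg])⟩

/-- In a noncyclic group neither generator is a multiple of the other, which leaves only the two
relations between doubles to be assumed away. -/
theorem NoShortRelations.of_not_isAddCyclic {p q : Γ} (hc : ¬ IsAddCyclic Γ)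
    (hgen : AddSubgroup.closure {p, q} = ⊤) (h : p + p ≠ q + q) (h' : p + p ≠ -(q + q)) :
    NoShortRelations p q := by
  have h1 : ∀ k : ℤ, p ≠ k • q := fun k hk =>
    hc (isAddCyclic_of_closure_pair_of_zsmul hgen k hk)
  have h2 : ∀ k : ℤ, q ≠ k • p := fun k hk =>
    hc (isAddCyclic_of_closure_pair_of_zsmul (Set.pair_comm p q ▸ hgen) k hk)
  refine ⟨?_, ?_, ?_, ?_, ?_, ?_, h, h'⟩
  · simpa using h1 1
  · simpa using h1 (-1)
  · exact fun e => h1 3 (by rw [e]; abel)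
  · exact fun e => h1 (-3) (by rw [e]; abel)
  · exact fun e => h2 3 (by rw [e]; abel)
  · exact fun e => h2 (-3) (by rw [e]; abel)

theorem signedPair_map {R : Type*} [AddCommGroup R] {ι : Γ →+ R} (hι : Function.Injective ι)
    {p q x : Γ} : ι x ∈ signedPair (ι p) (ι q) ↔ x ∈ signedPair p q := by
  simp only [mem_signedPair, ← map_neg, hι.eq_iff]

theorem NoShortRelations.map {R : Type*} [AddCommGroup R] {ι : Γ →+ R}
    (hι : Function.Injective ι) {p q : Γ} (h : NoShortRelations p q) :
    NoShortRelations (ι p) (ι q) := by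
  obtain ⟨h1, h2, h3, h4, h5, h6, h7, h8⟩ := h
  constructor <;> simp only [← map_neg, ← map_add, hι.ne_iff] <;> assumption

end Group

variable {Δ R : Type*} [CommRing Δ] [CommRing R]

/-- When 4q ≠ 0, the only common neighbour of q and -q is 0. This is how the graph alone recognises
the pair ±q. -/
theorem NoShortRelations.eq_neg_of_add_eq {p q s t : R} (h : NoShortRelations p q)
    (hq : q + q + (q + q) ≠ 0) (hs : s ∈ signedPair p q) (ht : t ∈ signedPair p q)
    (hst : q + s = -q + t) : s = -q := by
  obtain ⟨h1, h2, h3, h4, h5, h6, h7, h8⟩ := h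
  rw [mem_signedPair] at hs ht
  rcases hs with rfl | rfl | rfl | rfl <;> rcases ht with rfl | rfl | rfl | rfl <;> grind

/-- A representation w = s + t can be swapped if s ≠ t. If s = t, then 4s = 0 gives w = (-s) + (-s),
and this is new because w ≠ 0. -/
theorem exists_ne_rep_of_four_eq_zero {p q w s : R}
    (hp : p + p + (p + p) = 0) (hq : q + q + (q + q) = 0) (hw : w ≠ 0)
    (hs : s ∈ signedPair p q) (hws : w - s ∈ signedPair p q) :
    ∃ s' ∈ signedPair p q, s' ≠ s ∧ w - s' ∈ signedPair p q := by
  by_cases hst : w = s + s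
  · refine ⟨-s, neg_mem_signedPair hs, by grind, ?_⟩
    have : w - -s = -s := by
      rw [mem_signedPair] at hs
      grind
    rw [this]
    exact neg_mem_signedPair hs
  · exact ⟨w - s, hws, by grind, by simpa using hs⟩

theorem NoShortRelations.rep_unique {p q w s s' s'' : R} (h : NoShortRelations p q)
    (hp : p + p + (p + p) = 0) (hq : q + q + (q + q) = 0) (hw : w ≠ 0)
    (hs : s ∈ signedPair p q) (hws : w - s ∈ signedPair p q)
    (hs' : s' ∈ signedPair p q) (hws' : w - s' ∈ signedPair p q)
    (hs'' : s'' ∈ signedPair p q) (hws'' : w - s'' ∈ signedPair p q)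
    (h' : s' ≠ s) (h'' : s'' ≠ s) : s' = s'' := by
  obtain ⟨h1, h2, h3, h4, h5, h6, h7, h8⟩ := h
  have key : ∀ x ∈ signedPair p q, w - x ∈ signedPair p q → x ≠ s →
      (w = s + s ∧ x = -s) ∨ (w ≠ s + s ∧ x = w - s) := by
    clear h' h'' hs' hs'' hws' hws''
    intro x hx hwx hxs
    rw [mem_signedPair] at *
    obtain ⟨t, rfl⟩ : ∃ t, w = s + t := ⟨w - s, by simp⟩
    rw [add_sub_cancel_left] at *
    rcases hs with rfl | rfl | rfl | rfl <;> rcases hws with rfl | rfl | rfl | rfl <;>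
      rcases hx with rfl | rfl | rfl | rfl <;> grind
  have k1 := key s' hs' hws' h'
  have k2 := key s'' hs'' hws'' h''
  grind

variable {ψ : Δ → R} {B : Set Δ} {p q : R}

theorem neg_mem_of_equiv_signedPair
    (hψ : ∀ v w, w - v ∈ B ↔ ψ w - ψ v ∈ signedPair p q) {b : Δ} (hb : b ∈ B) : -b ∈ B := by
  have h1 := (hψ 0 b).1 (by simpa using hb)
  have h2 := neg_mem_signedPair h1
  rw [neg_sub] at h2
  simpa using (hψ b 0).2 h2

/-- If all elements have order dividing four, any two vertices of the Cayley graph on `{±p, ±q}`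
have no or exactly two common neighbours, which forces the other group to have exponent four. -/
theorem four_nsmul_eq_zero_of_equiv_signedPair (h : NoShortRelations p q)
    (hp : p + p + (p + p) = 0) (hq : q + q + (q + q) = 0)
    (hinj : Function.Injective ψ)
    (hsur : ∀ v, ∀ s ∈ signedPair p q, ∃ w, ψ w = ψ v + s)
    (hψ : ∀ v w, w - v ∈ B ↔ ψ w - ψ v ∈ signedPair p q) {b : Δ} (hb : b ∈ B) :
    b + b + (b + b) = 0 := by
  have ex : ∀ w ≠ 0, ∀ x ∈ B, w - x ∈ B → ∃ x' ∈ B, x' ≠ x ∧ w - x' ∈ B := by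
    intro w hw x hx hwx
    have h1 := (hψ 0 x).1 (by simpa using hx)
    have h2 := (hψ x w).1 hwx
    obtain ⟨s, hs, hne, hs'⟩ := exists_ne_rep_of_four_eq_zero (w := ψ w - ψ 0) (s := ψ x - ψ 0) hp hq
      (by simpa [sub_eq_zero, hinj.eq_iff] using hw) h1 (by simpa using h2)
    obtain ⟨y, hy⟩ := hsur 0 s hs
    have hy' : s = ψ y - ψ 0 := by rw [hy, add_sub_cancel_left]
    subst hy'
    refine ⟨y, ?_, ?_, ?_⟩
    · simpa using (hψ 0 y).2 hs
    · rintro rfl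
      exact hne rfl
    · exact (hψ _ _).2 (by simpa using hs')
  have un : ∀ w ≠ 0, ∀ x ∈ B, w - x ∈ B → ∀ y ∈ B, w - y ∈ B → ∀ z ∈ B, w - z ∈ B →
      y ≠ x → z ≠ x → y = z := by
    intro w hw x hx hwx y hy hwy z hz hwz hyx hzx
    have h0 : ∀ u ∈ B, ψ u - ψ 0 ∈ signedPair p q := fun u hu =>
      (hψ 0 u).1 (by simpa using hu)
    have h1 : ∀ u, w - u ∈ B → ψ w - ψ 0 - (ψ u - ψ 0) ∈ signedPair p q := fun u hu => by
      simpa using (hψ u w).1 hu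
    have := h.rep_unique hp hq (by simpa [sub_eq_zero, hinj.eq_iff] using hw) (h0 x hx) (h1 x hwx)
      (h0 y hy) (h1 y hwy) (h0 z hz) (h1 z hwz) (by simpa [hinj.eq_iff] using hyx) (by simpa [hinj.eq_iff] using hzx)
    simpa [hinj.eq_iff] using this
  have neg : ∀ x ∈ B, -x ∈ B := fun x hx => neg_mem_of_equiv_signedPair hψ hx
  by_contra h4
  have h2 : b + b ≠ 0 := by intro h0; simp [h0] at h4
  obtain ⟨x, hx, hxb, hbx⟩ := ex (b + b) h2 b hb (by simpa using hb)
  -- The second representation x + (2b - x) of 2b must be its own swap, hence 2x = 2b.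
  have hxx : x = b + b - x := by
    refine un (b + b) h2 b hb (by simpa using hb) x hx hbx _ hbx (by simpa using hx) hxb ?_
    grind
  have hxn : b - x ≠ 0 := by grind
  -- Since 2x = 2b, the element b - x has representations starting with x, b and -x. Uniqueness of
  -- the second one gives b = -x, whence 4b = 0.
  have := un (b - x) hxn x hx (by convert neg b hb using 1; grind) b hb
    (by convert neg x hx using 1; grind) (-x) (neg x hx) (by convert hb using 1; grind)
    (by grind) (by grind)
  grind

theorem map_add_neg_of_equiv_signedPair (h : NoShortRelations p q)
    (hq : q + q + (q + q) ≠ 0)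
    (hinj : Function.Injective ψ)
    (hsur : ∀ v, ∀ s ∈ signedPair p q, ∃ w, ψ w = ψ v + s)
    (hinv : ∀ b c : Δ, b + b = 0 → c + c = 0 → b ≠ 0 → c ≠ 0 → b = c)
    (hB0 : (0 : Δ) ∉ B)
    (hψ : ∀ v w, w - v ∈ B ↔ ψ w - ψ v ∈ signedPair p q) (v : Δ) {b : Δ} (hb : b ∈ B) :
    ψ (v + -b) - ψ v = -(ψ (v + b) - ψ v) := by
  have neg : ∀ x ∈ B, -x ∈ B := fun x hx => neg_mem_of_equiv_signedPair hψ hx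
  have mem : ∀ v, ∀ b ∈ B, ψ (v + b) - ψ v ∈ signedPair p q := fun v b hb =>
    (hψ v (v + b)).1 (by simpa using hb)
  have inj : ∀ b c, ψ (v + b) - ψ v = ψ (v + c) - ψ v → b = c := fun b c h => by simpa [hinj.eq_iff] using h
  have sur : ∀ s ∈ signedPair p q, ∃ b ∈ B, ψ (v + b) - ψ v = s := by
    intro s hs
    obtain ⟨w, hw⟩ := hsur v s hs
    refine ⟨w - v, (hψ v w).2 ?_, ?_⟩ <;> simp [hw, hs]
  have hqS : q ∈ signedPair p q := by simp [signedPair]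
  obtain ⟨d, hd, hdq⟩ := sur q hqS
  obtain ⟨e, he, heq⟩ := sur (-q) (neg_mem_signedPair hqS)
  -- v + d + e is a common neighbour of v + d and v + e, whose images are ψ v ± q, so it is mapped
  -- to ψ v.
  have hed : e = -d := by
    have h1 := mem (v + d) e he
    have h2 := mem (v + e) d hd
    rw [add_right_comm v e d] at h2
    have h3 := h.eq_neg_of_add_eq hq h1 h2 (by grind)
    have h4 : ψ (v + d + e) = ψ v := by grind
    have h5 := hinj h4
    grind
  subst hed
  by_cases hbd : b = d
  · subst hbd; rw [hdq, heq]
  by_cases hbd' : b = -d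
  · subst hbd'; rw [neg_neg, hdq, heq, neg_neg]
  have key : ∀ c ∈ B, c ≠ d → c ≠ -d →
      ψ (v + c) - ψ v = p ∨ ψ (v + c) - ψ v = -p := by
    intro c hc hcd hcd'
    have h1 := mem v c hc
    have h2 := mt (inj c d) hcd
    have h3 := mt (inj c (-d)) hcd'
    rw [mem_signedPair] at h1
    grind
  have hσb := key b hb hbd hbd'
  have hσnb := key (-b) (neg b hb) (by grind) (by grind)
  by_contra hne
  -- Both steps lie in ±p and are not opposite, so they coincide and b is an involution. The
  -- preimage c of the opposite step is then an involution too, and `hinv` allows only one.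
  have hbb : b = -b := inj _ _ (by grind)
  obtain ⟨c, hc, hcb⟩ := sur (-(ψ (v + b) - ψ v)) (neg_mem_signedPair (mem v b hb))
  have hcd : c ≠ d := by rintro rfl; have := h.ne; have := h.ne_neg; grind
  have hcd' : c ≠ -d := by rintro rfl; have := h.ne; have := h.ne_neg; grind
  have hσnc := key (-c) (neg c hc) (by grind) (by grind)
  have hcc : c = -c := by
    by_cases h0 : ψ (v + -c) - ψ v = ψ (v + b) - ψ v
    · have := inj _ _ h0
      grind
    · exact inj _ _ (by grind)
  have hbc : b = c := hinv b c (by grind) (by grind) (fun h => hB0 (h ▸ hb))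
    (fun h => hB0 (h ▸ hc))
  subst hbc
  rw [← hbb] at hne
  exact hne hcb

/-- Antipodality at v + b makes ψ go straight along multiples of b. In a square with c ≠ ±b,
opposite sides then agree up to sign, and a genuine sign change would force 2p = ±2q. -/
theorem step_const_of_map_add_neg (h : NoShortRelations p q)
    (hinj : Function.Injective ψ)
    (hψ : ∀ v w, w - v ∈ B ↔ ψ w - ψ v ∈ signedPair p q)
    (hneg : ∀ v, ∀ b ∈ B, ψ (v + -b) - ψ v = -(ψ (v + b) - ψ v)) (v : Δ) {b c : Δ}
    (hb : b ∈ B) (hc : c ∈ B) : ψ (v + b + c) - ψ (v + b) = ψ (v + c) - ψ v := by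
  have neg : ∀ x ∈ B, -x ∈ B := fun x hx => neg_mem_of_equiv_signedPair hψ hx
  have mem : ∀ v, ∀ b ∈ B, ψ (v + b) - ψ v ∈ signedPair p q := fun v b hb =>
    (hψ v (v + b)).1 (by simpa using hb)
  have inj : ∀ v b c, ψ (v + b) - ψ v = ψ (v + c) - ψ v → b = c := fun v b c h => by
    simpa [hinj.eq_iff] using h
  have same : ∀ v, ∀ b ∈ B, ψ (v + b + b) - ψ (v + b) = ψ (v + b) - ψ v := by
    intro v b hb
    have h1 := hneg (v + b) b hb
    rw [add_neg_cancel_right] at h1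
    grind
  by_cases hcb : c = b
  · subst hcb; exact same v c hc
  by_cases hcb' : c = -b
  · subst hcb'
    have h1 := hneg v b hb
    rw [add_neg_cancel_right]
    grind
  have h1 := mem v b hb
  have h2 := mem v c hc
  have h3 := mem (v + b) c hc
  have h4 := mem (v + c) b hb
  have h5 := mt (inj v c b) hcb
  have h6 := mt (inj v c (-b)) hcb'
  have h7 := mt (inj (v + b) c b) hcb
  have h8 := mt (inj (v + b) c (-b)) hcb'
  have h9 := mt (inj (v + c) b c) (Ne.symm hcb)
  have h10 := mt (inj (v + c) b (-c)) (by grind)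
  rw [hneg v b hb] at h6
  rw [hneg (v + b) b hb] at h8
  rw [hneg (v + c) c hc] at h10
  rw [same v b hb] at h7 h8
  rw [same v c hc] at h9 h10
  rw [add_right_comm v c b] at h4 h9 h10
  have hsum : (ψ (v + b) - ψ v) + (ψ (v + b + c) - ψ (v + b)) =
      (ψ (v + c) - ψ v) + (ψ (v + b + c) - ψ (v + c)) := by abel
  generalize ψ (v + b) - ψ v = x at *
  generalize ψ (v + b + c) - ψ (v + b) = y' at *
  generalize ψ (v + c) - ψ v = y at *
  generalize ψ (v + b + c) - ψ (v + c) = x' at *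
  obtain ⟨-, -, -, -, -, -, k7, k8⟩ := h
  rw [mem_signedPair] at h1 h2 h3 h4
  clear hψ hneg neg mem inj same
  grind

end Antipodal

/-! ### Cyclic groups against Γ: the rigidity theorem for graphs, and fibre-preserving bijections.
-/

section Circulant

/-- The only possible involution of ℤ/r is r/2. -/
theorem ZMod.eq_of_add_self_eq_zero {r : ℕ} (hr : 0 < r) {b c : ZMod r} (hb : b + b = 0)
    (hc : c + c = 0) (hb0 : b ≠ 0) (hc0 : c ≠ 0) : b = c := by
  have : NeZero r := ⟨hr.ne'⟩
  have key : ∀ x : ZMod r, x + x = 0 → x ≠ 0 → 2 * x.val = r := by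
    intro x hx hx0
    have h1 : r ∣ x.val + x.val := by
      rw [← ZMod.natCast_eq_zero_iff, Nat.cast_add, ZMod.natCast_zmod_val, hx]
    have h2 := ZMod.val_lt x
    have h3 : x.val ≠ 0 := by rwa [Ne, ZMod.val_eq_zero]
    obtain ⟨k, hk⟩ := h1
    have : k = 1 := by
      have hk2 : k < 2 := by by_contra h; nlinarith
      have : k ≠ 0 := by rintro rfl; omega
      omega
    subst this
    omega
  apply ZMod.val_injective
  have := key b hb hb0
  have := key c hc hc0
  omega

variable {Γ : Type*} [AddCommGroup Γ]

theorem isAddCyclic_of_graph_equiv_zmod {r : ℕ} (hr : 0 < r) (ψ : ZMod r ≃ Γ)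
    {B : Set (ZMod r)} {p q : Γ} (hgen : AddSubgroup.closure {p, q} = ⊤)
    (hB0 : (0 : ZMod r) ∉ B)
    (hψ : ∀ v w, w - v ∈ B ↔ ψ w - ψ v ∈ signedPair p q)
    (h : p + p ≠ q + q) (h' : p + p ≠ -(q + q)) : IsAddCyclic Γ := by
  by_contra hcyc
  have : NeZero r := ⟨hr.ne'⟩
  have hr := NoShortRelations.of_not_isAddCyclic hcyc hgen h h'
  have hS : AddSubgroup.closure (signedPair p q) = ⊤ := by
    rw [eq_top_iff, ← hgen]
    refine AddSubgroup.closure_mono ?_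
    rintro x (rfl | rfl) <;> simp [signedPair]
  have hBS : ∀ v w, ψ w - ψ v ∈ signedPair p q → w - v ∈ B := fun v w => (hψ v w).2
  obtain ⟨R, _, ι, hι⟩ := exists_injective_addMonoidHom_commRing Γ
  have hr' := hr.map hι
  have hinj : Function.Injective (ι ∘ ψ) := hι.comp ψ.injective
  have hsur : ∀ v, ∀ s ∈ signedPair (ι p) (ι q), ∃ w, (ι ∘ ψ) w = (ι ∘ ψ) v + s := by
    intro v s hs
    obtain ⟨t, rfl⟩ : ∃ t, ι t = s := by
      rw [mem_signedPair] at hs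
      simp only [← map_neg] at hs
      rcases hs with rfl | rfl | rfl | rfl <;> exact ⟨_, rfl⟩
    exact ⟨ψ.symm (ψ v + t), by simp⟩
  have hψ' : ∀ v w, w - v ∈ B ↔ (ι ∘ ψ) w - (ι ∘ ψ) v ∈ signedPair (ι p) (ι q) := by
    intro v w
    rw [hψ, ← signedPair_map hι, map_sub]
    rfl
  have hinv : ∀ b c : ZMod r, b + b = 0 → c + c = 0 → b ≠ 0 → c ≠ 0 → b = c :=
    fun b c hb hc => ZMod.eq_of_add_self_eq_zero ‹_› hb hc
  have hfour : ∀ x : Γ, ι x + ι x + (ι x + ι x) = 0 ↔ x + x + (x + x) = 0 := by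
    intro x
    rw [← map_add, ← map_add, map_eq_zero_iff ι hι]
  have hconst : ∀ v, ∀ b ∈ B, ∀ c ∈ B, (ι ∘ ψ) (v + b + c) - (ι ∘ ψ) (v + b) =
      (ι ∘ ψ) (v + c) - (ι ∘ ψ) v := by
    intro v b hb c hc
    by_cases hq : q + q + (q + q) = 0
    · by_cases hp : p + p + (p + p) = 0
      · exfalso
        -- When 4p = 4q = 0, the cyclic group has exponent dividing 4, so |Γ| divides 4. As 2p ≠ 2q,
        -- one generator has order 4 and Γ is cyclic after all.
        have hfourB : ∀ x : ZMod r, (4 : ℕ) • x = 0 := by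
          intro x
          have hx : x ∈ AddSubgroup.closure B :=
            closure_eq_top_of_steps ψ hS hBS ▸ AddSubgroup.mem_top x
          induction hx using AddSubgroup.closure_induction with
          | mem b hb =>
            rw [← four_nsmul_eq_zero_of_equiv_signedPair hr' ((hfour p).2 hp) ((hfour q).2 hq)
              hinj hsur hψ' hb]
            abel
          | zero => simp
          | add x y _ _ hx hy => rw [nsmul_add, hx, hy, add_zero]
          | neg x _ hx => rw [smul_neg, hx, neg_zero]
        have hr4 : Nat.card Γ ∣ 4 := by
          rw [← Nat.card_congr ψ, ← IsAddCyclic.exponent_eq_card]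
          exact AddMonoid.exponent_dvd_of_forall_nsmul_eq_zero hfourB
        have hcard : ∀ x : Γ, x + x ≠ 0 → x + x + (x + x) = 0 → False := by
          intro x hx hx4
          have : Finite Γ := Finite.of_equiv _ ψ
          have h1 : addOrderOf x = 2 ^ (1 + 1) := by
            apply addOrderOf_eq_prime_pow
            · simpa [two_nsmul] using hx
            · rw [← hx4]; abel
          refine hcyc (isAddCyclic_of_addOrderOf_eq_card x (Nat.dvd_antisymm ?_ ?_))
          · exact addOrderOf_dvd_natCard x
          · rw [h1]; exact hr4
        by_cases hp2 : p + p = 0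
        · exact hcard q (fun hq2 => h (hp2.trans hq2.symm)) hq
        · exact hcard p hp2 hp
      -- Here 4p ≠ 0, so p takes over the role of q.
      · rw [signedPair_comm] at hψ' hsur
        exact step_const_of_map_add_neg hr'.symm hinj hψ' (fun v b hb =>
          map_add_neg_of_equiv_signedPair hr'.symm (mt (hfour p).1 hp) hinj hsur hinv hB0 hψ' v hb)
          v hb hc
    · exact step_const_of_map_add_neg hr' hinj hψ' (fun v b hb =>
        map_add_neg_of_equiv_signedPair hr' (mt (hfour q).1 hq) hinj hsur hinv hB0 hψ' v hb)
        v hb hc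
  refine hcyc (isAddCyclic_of_step_const ψ hS hBS fun v b hb c hc => hι ?_)
  simpa using hconst v b hb c hc

/-- A surjection from `Γ` whose kernel is generated by the involution `a₁ - a₂`. -/
theorem exists_hom_of_addOrderOf_sub_eq_two [Finite Γ] {a₁ a₂ : Γ}
    (hgen : AddSubgroup.closure {a₁, a₂} = ⊤) (h : addOrderOf (a₁ - a₂) = 2) :
    ∃ (e : ℕ) (π : Γ →+ ZMod e), Function.Surjective π ∧ Nat.card Γ = e * 2 ∧
      ∀ x, π x = 0 ↔ x = 0 ∨ x = a₁ - a₂ := by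
  set K := AddSubgroup.zmultiples (a₁ - a₂) with hK
  have hmem : ∀ x, x ∈ K ↔ x = 0 ∨ x = a₁ - a₂ := by
    intro x
    have h2 : (2 : ℕ) • (a₁ - a₂) = 0 := h ▸ addOrderOf_nsmul_eq_zero _
    constructor
    · rintro ⟨k, rfl⟩
      have h2' : (2 : ℤ) • (a₁ - a₂) = 0 := by exact_mod_cast h2
      rcases Int.even_or_odd' k with ⟨j, rfl | rfl⟩
      · left; simp only [mul_comm (2 : ℤ), mul_smul, h2', smul_zero]
      · right; simp only [add_smul, mul_comm (2 : ℤ), mul_smul, h2', smul_zero, one_smul, zero_add]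
    · rintro (rfl | rfl)
      · exact zero_mem _
      · exact AddSubgroup.mem_zmultiples _
  have hcyc : IsAddCyclic (Γ ⧸ K) := by
    refine isAddCyclic_of_closure_pair_of_zsmul (a₁ := (a₁ : Γ ⧸ K)) (a₂ := (a₂ : Γ ⧸ K)) ?_ 1 ?_
    · have := congrArg (AddSubgroup.map (QuotientAddGroup.mk' K)) hgen
      rw [AddMonoidHom.map_closure, Set.image_pair, ← AddMonoidHom.range_eq_map,
        AddMonoidHom.range_eq_top.2 (QuotientAddGroup.mk'_surjective K)] at this
      exact this
    · rw [one_smul, QuotientAddGroup.eq, hmem, neg_add_eq_sub]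
      have h2 : (2 : ℕ) • (a₁ - a₂) = 0 := h ▸ addOrderOf_nsmul_eq_zero _
      rw [two_nsmul] at h2
      right
      rw [← neg_sub, neg_eq_iff_add_eq_zero, h2]
  let f := (zmodAddCyclicAddEquiv hcyc).symm
  refine ⟨Nat.card (Γ ⧸ K), f.toAddMonoidHom.comp (QuotientAddGroup.mk' K),
    f.surjective.comp (QuotientAddGroup.mk'_surjective K), ?_, fun x => ?_⟩
  · rw [AddSubgroup.card_eq_card_quotient_mul_card_addSubgroup K, Nat.card_zmultiples, h]
  · rw [← hmem, ← QuotientAddGroup.eq_zero_iff]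
    simp [f]

theorem card_eq_card_mul_card_fiber {Q : Type*} [AddCommGroup Q] (φ : Γ →+ Q)
    (hφ : Function.Surjective φ) (y : Q) :
    Nat.card Γ = Nat.card Q * Nat.card {x // φ x = y} := by
  have hker : Nat.card {x // φ x = y} = Nat.card φ.ker := by
    obtain ⟨x₀, rfl⟩ := hφ y
    refine Nat.card_congr ((Equiv.subRight x₀).subtypeEquiv fun x => ?_)
    simp [AddMonoidHom.mem_ker, sub_eq_zero]
  rw [hker, AddSubgroup.card_eq_card_quotient_mul_card_addSubgroup φ.ker,
    Nat.card_congr (QuotientAddGroup.quotientKerEquivOfSurjective φ hφ).toEquiv]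

/-- Two surjections between finite groups of the same order agree up to a bijection. -/
theorem exists_equiv_comp_eq {Δ Q : Type*} [AddCommGroup Δ] [AddCommGroup Q] [Finite Γ] [Finite Δ]
    (hcard : Nat.card Γ = Nat.card Δ) (π : Γ →+ Q) (ρ : Δ →+ Q) (hπ : Function.Surjective π)
    (hρ : Function.Surjective ρ) : ∃ f : Γ ≃ Δ, ∀ x, ρ (f x) = π x := by
  have hQ : 0 < Nat.card Q := by
    have : Finite Q := Finite.of_surjective π hπ
    exact Nat.card_pos
  have e : ∀ y, Nonempty ({x // π x = y} ≃ {x // ρ x = y}) := fun y =>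
    Finite.card_eq.1 (Nat.eq_of_mul_eq_mul_left hQ
      ((card_eq_card_mul_card_fiber π hπ y).symm.trans
        (hcard.trans (card_eq_card_mul_card_fiber ρ hρ y))))
  exact ⟨Equiv.ofFiberEquiv fun y => (e y).some, fun x => Equiv.ofFiberEquiv_map _ x⟩

end Circulant

/-! ### Criteria in terms of the group and the orders of a₁ ± a₂. -/

section CirculantIff

variable {Γ : Type*} [AddCommGroup Γ]

theorem cayleyDigraph_isCirculant_iff (A : Set Γ) :
    (cayleyDigraph A).IsCirculant ↔ ∃ r : ℕ, 0 < r ∧ ∃ B : Set (ZMod r), (0 : ZMod r) ∉ B ∧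
      ∃ ψ : ZMod r ≃ Γ, ∀ v w, w - v ∈ B ↔ ψ w - ψ v ∈ A := by
  refine exists_congr fun r => and_congr_right fun _ => exists_congr fun B =>
    and_congr_right fun _ => ⟨?_, ?_⟩
  · rintro ⟨φ⟩
    refine ⟨φ.toEquiv.symm, fun v w => ?_⟩
    have := φ.symm.map_rel_iff (a := v) (b := w)
    simp only [cayleyDigraph, neg_add_eq_sub] at this
    exact this.symm
  · rintro ⟨ψ, hψ⟩
    refine ⟨⟨ψ.symm, fun {v w} => ?_⟩⟩
    simp [cayleyDigraph, neg_add_eq_sub, hψ]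

theorem circulantGraph_pair_adj {a₁ a₂ : Γ} (h₁ : a₁ ≠ 0) (h₂ : a₂ ≠ 0) (u v : Γ) :
    (SimpleGraph.circulantGraph {a₁, a₂}).Adj u v ↔ v - u ∈ signedPair a₁ a₂ := by
  rw [SimpleGraph.circulantGraph_adj, mem_signedPair, Set.mem_insert_iff, Set.mem_insert_iff,
    Set.mem_singleton_iff, Set.mem_singleton_iff, ← neg_sub v u, neg_eq_iff_eq_neg,
    neg_eq_iff_eq_neg]
  constructor
  · tauto
  · intro h
    refine ⟨?_, by tauto⟩
    rintro rfl
    rw [sub_self] at h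
    rcases h with h | h | h | h <;> simp_all [eq_comm]

theorem circulantGraph_adj_of_neg_mem {B : Set Γ} (h0 : (0 : Γ) ∉ B) (hB : ∀ b ∈ B, -b ∈ B)
    (u v : Γ) : (SimpleGraph.circulantGraph B).Adj u v ↔ v - u ∈ B := by
  rw [SimpleGraph.circulantGraph_adj]
  constructor
  · rintro ⟨-, h | h⟩
    · simpa using hB _ h
    · exact h
  · intro h
    refine ⟨?_, Or.inr h⟩
    rintro rfl
    exact h0 (by simpa using h)

theorem circulantGraph_pair_isCirculant_iff {a₁ a₂ : Γ} (h₁ : a₁ ≠ 0) (h₂ : a₂ ≠ 0) :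
    (SimpleGraph.circulantGraph {a₁, a₂}).IsCirculant ↔
      ∃ r : ℕ, 0 < r ∧ ∃ B : Set (ZMod r), (0 : ZMod r) ∉ B ∧
        ∃ ψ : ZMod r ≃ Γ, ∀ v w, w - v ∈ B ↔ ψ w - ψ v ∈ signedPair a₁ a₂ := by
  refine exists_congr fun r => and_congr_right fun _ => exists_congr fun B =>
    and_congr_right fun h0 => ⟨?_, ?_⟩
  · rintro ⟨hB, ⟨φ⟩⟩
    refine ⟨φ.toEquiv.symm, fun v w => ?_⟩
    have := φ.symm.map_rel_iff (a := v) (b := w)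
    rw [circulantGraph_adj_of_neg_mem h0 hB, circulantGraph_pair_adj h₁ h₂] at this
    exact this.symm
  · rintro ⟨ψ, hψ⟩
    have hB : ∀ b ∈ B, -b ∈ B := by
      intro b hb
      have h1 := (hψ 0 b).1 (by simpa using hb)
      have h2 := neg_mem_signedPair h1
      rw [neg_sub] at h2
      simpa using (hψ b 0).2 h2
    refine ⟨hB, ⟨⟨ψ.symm, fun {v w} => ?_⟩⟩⟩
    rw [circulantGraph_adj_of_neg_mem h0 hB, circulantGraph_pair_adj h₁ h₂, hψ]
    simp

/-- Adjacency seen only through ℤ/e makes the graph a blow-up of a circulant with fibres of size k.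
ℤ/ek gives the same blow-up, so the bijection need not be additive. -/
theorem exists_equiv_zmod_of_hom [Finite Γ] {e k : ℕ} (π : Γ →+ ZMod e)
    (hπ : Function.Surjective π) (hcard : Nat.card Γ = e * k) {T : Set (ZMod e)}
    (hT : (0 : ZMod e) ∉ T) :
    ∃ r : ℕ, 0 < r ∧ ∃ B : Set (ZMod r), (0 : ZMod r) ∉ B ∧
      ∃ ψ : ZMod r ≃ Γ, ∀ v w, w - v ∈ B ↔ π (ψ w - ψ v) ∈ T := by
  have hpos : 0 < e * k := hcard ▸ Nat.card_pos
  have : NeZero (e * k) := ⟨hpos.ne'⟩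
  let ρ : ZMod (e * k) →+* ZMod e := ZMod.castHom (Dvd.intro k rfl) (ZMod e)
  obtain ⟨f, hf⟩ := exists_equiv_comp_eq (by rw [hcard, Nat.card_zmod]) π ρ.toAddMonoidHom hπ
    (ZMod.ringHom_surjective ρ)
  refine ⟨e * k, hpos, ρ ⁻¹' T, by simpa using hT, f.symm, fun v w => ?_⟩
  rw [map_sub, ← hf, ← hf]
  simp

theorem exists_equiv_zmod_of_isAddCyclic [Finite Γ] [h : IsAddCyclic Γ] {A : Set Γ}
    (hA : (0 : Γ) ∉ A) :
    ∃ r : ℕ, 0 < r ∧ ∃ B : Set (ZMod r), (0 : ZMod r) ∉ B ∧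
      ∃ ψ : ZMod r ≃ Γ, ∀ v w, w - v ∈ B ↔ ψ w - ψ v ∈ A := by
  let f := zmodAddCyclicAddEquiv h
  refine ⟨Nat.card Γ, Nat.card_pos, f ⁻¹' A, by simpa using hA, f.toEquiv, fun v w => ?_⟩
  simp

theorem addOrderOf_sub_eq_two {a₁ a₂ : Γ} (hne : a₁ ≠ a₂) (h : a₁ + a₁ = a₂ + a₂) :
    addOrderOf (a₁ - a₂) = 2 := by
  rw [addOrderOf_eq_prime_iff, two_nsmul, sub_add_sub_comm, h]
  exact ⟨sub_self _, sub_ne_zero.2 hne⟩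

/-- As a₁ - a₂ is its own negative, {a₁, a₂} is a full fibre of π, so the connection set comes from
the quotient. -/
theorem hom_eq_iff_of_ker {Q : Type*} [AddCommGroup Q] {a₁ a₂ : Γ} {π : Γ →+ Q}
    (ht : addOrderOf (a₁ - a₂) = 2)
    (hker : ∀ x, π x = 0 ↔ x = 0 ∨ x = a₁ - a₂) (x : Γ) : π x = π a₁ ↔ x = a₁ ∨ x = a₂ := by
  have h2 : (2 : ℕ) • (a₁ - a₂) = 0 := ht ▸ addOrderOf_nsmul_eq_zero _
  have h3 : a₁ - a₂ = a₂ - a₁ := by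
    rw [two_nsmul] at h2
    rw [← neg_sub a₁ a₂, eq_neg_iff_add_eq_zero, h2]
  rw [← sub_eq_zero, ← map_sub, hker, sub_eq_zero, h3, sub_left_inj]

theorem map_ne_zero_of_ker {Q : Type*} [AddCommGroup Q] {a₁ a₂ : Γ} {π : Γ →+ Q}
    (h₁ : a₁ ≠ 0) (h₂ : a₂ ≠ 0) (hker : ∀ x, π x = 0 ↔ x = 0 ∨ x = a₁ - a₂) : π a₁ ≠ 0 := by
  rw [Ne, hker]
  rintro (h | h)
  · exact h₁ h
  · exact h₂ (by simpa using h.symm)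

theorem cayleyDigraph_pair_isCirculant_iff [Finite Γ] {a₁ a₂ : Γ} (h₁ : a₁ ≠ 0) (h₂ : a₂ ≠ 0)
    (hgen : AddSubgroup.closure {a₁, a₂} = ⊤) :
    (cayleyDigraph {a₁, a₂}).IsCirculant ↔ IsAddCyclic Γ ∨ addOrderOf (a₁ - a₂) = 2 := by
  rw [cayleyDigraph_isCirculant_iff]
  constructor
  · rintro ⟨r, -, B, -, ψ, hψ⟩
    by_cases h : a₁ + a₁ = a₂ + a₂
    · by_cases hne : a₁ = a₂
      · exact Or.inl (isAddCyclic_of_closure_pair_of_zsmul hgen 1 (by simpa using hne))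
      · exact Or.inr (addOrderOf_sub_eq_two hne h)
    · exact Or.inl (isAddCyclic_of_digraph_equiv ψ hgen hψ h)
  · rintro (h | h)
    · exact exists_equiv_zmod_of_isAddCyclic (by simp [h₁.symm, h₂.symm])
    · obtain ⟨e, π, hπ, hcard, hker⟩ := exists_hom_of_addOrderOf_sub_eq_two hgen h
      obtain ⟨r, hr, B, hB, ψ, hψ⟩ := exists_equiv_zmod_of_hom π hπ hcard (T := {π a₁})
        (by simpa [eq_comm] using map_ne_zero_of_ker h₁ h₂ hker)
      refine ⟨r, hr, B, hB, ψ, fun v w => ?_⟩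
      rw [hψ, Set.mem_singleton_iff, hom_eq_iff_of_ker h hker]
      rfl

theorem exists_equiv_zmod_signedPair [Finite Γ] {a₁ a₂ : Γ} (h₁ : a₁ ≠ 0) (h₂ : a₂ ≠ 0)
    (hgen : AddSubgroup.closure {a₁, a₂} = ⊤) (h : addOrderOf (a₁ - a₂) = 2) :
    ∃ r : ℕ, 0 < r ∧ ∃ B : Set (ZMod r), (0 : ZMod r) ∉ B ∧
      ∃ ψ : ZMod r ≃ Γ, ∀ v w, w - v ∈ B ↔ ψ w - ψ v ∈ signedPair a₁ a₂ := by
  obtain ⟨e, π, hπ, hcard, hker⟩ := exists_hom_of_addOrderOf_sub_eq_two hgen h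
  have hne := map_ne_zero_of_ker h₁ h₂ hker
  obtain ⟨r, hr, B, hB, ψ, hψ⟩ := exists_equiv_zmod_of_hom π hπ hcard (T := {π a₁, -π a₁})
    (by simpa [eq_comm] using hne)
  refine ⟨r, hr, B, hB, ψ, fun v w => ?_⟩
  rw [hψ, Set.mem_insert_iff, Set.mem_singleton_iff, ← neg_eq_iff_eq_neg, ← map_neg,
    hom_eq_iff_of_ker h hker, hom_eq_iff_of_ker h hker, mem_signedPair, neg_eq_iff_eq_neg,
    neg_eq_iff_eq_neg]
  tauto

theorem signedPair_neg_right (a₁ a₂ : Γ) : signedPair a₁ (-a₂) = signedPair a₁ a₂ := by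
  ext x
  simp only [mem_signedPair, neg_neg]
  tauto

theorem closure_pair_neg_right (a₁ a₂ : Γ) :
    AddSubgroup.closure {a₁, -a₂} = AddSubgroup.closure {a₁, a₂} := by
  apply le_antisymm <;> rw [AddSubgroup.closure_le] <;> rintro x (rfl | rfl)
  · exact AddSubgroup.subset_closure (by simp)
  · exact neg_mem (AddSubgroup.subset_closure (by simp))
  · exact AddSubgroup.subset_closure (by simp)
  · rw [← neg_neg x]
    exact neg_mem (AddSubgroup.subset_closure (by simp))

theorem circulantGraph_pair_isCirculant_iff_addOrderOf [Finite Γ] {a₁ a₂ : Γ} (h₁ : a₁ ≠ 0)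
    (h₂ : a₂ ≠ 0) (hgen : AddSubgroup.closure {a₁, a₂} = ⊤) :
    (SimpleGraph.circulantGraph {a₁, a₂}).IsCirculant ↔
      IsAddCyclic Γ ∨ addOrderOf (a₁ - a₂) = 2 ∨ addOrderOf (a₁ + a₂) = 2 := by
  rw [circulantGraph_pair_isCirculant_iff h₁ h₂]
  constructor
  · rintro ⟨r, hr, B, hB, ψ, hψ⟩
    by_cases h : a₁ + a₁ = a₂ + a₂
    · by_cases hne : a₁ = a₂
      · exact Or.inl (isAddCyclic_of_closure_pair_of_zsmul hgen 1 (by simpa using hne))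
      · exact Or.inr (Or.inl (addOrderOf_sub_eq_two hne h))
    by_cases h' : a₁ + a₁ = -(a₂ + a₂)
    · by_cases hne : a₁ = -a₂
      · exact Or.inl (isAddCyclic_of_closure_pair_of_zsmul hgen (-1) (by simpa using hne))
      · refine Or.inr (Or.inr ?_)
        rw [← sub_neg_eq_add]
        exact addOrderOf_sub_eq_two hne (by rw [h', neg_add])
    exact Or.inl (isAddCyclic_of_graph_equiv_zmod hr ψ hgen hB hψ h h')
  · rintro (h | h | h)
    · exact exists_equiv_zmod_of_isAddCyclic (by simp [mem_signedPair, h₁.symm, h₂.symm, h₁, h₂])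
    · exact exists_equiv_zmod_signedPair h₁ h₂ hgen h
    · rw [← signedPair_neg_right]
      exact exists_equiv_zmod_signedPair h₁ (neg_ne_zero.2 h₂)
        ((closure_pair_neg_right _ _).trans hgen) (by rwa [sub_neg_eq_add])

/-- Γ maps onto a cyclic group of order |Γ|/2, whose order divides the exponent of Γ. This will
force d_{n-1}(M) to divide 2. -/
theorem card_dvd_two_mul_exponent [Finite Γ] {a₁ a₂ : Γ}
    (hgen : AddSubgroup.closure {a₁, a₂} = ⊤) (h : addOrderOf (a₁ - a₂) = 2) :
    Nat.card Γ ∣ 2 * AddMonoid.exponent Γ := by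
  obtain ⟨e, π, hπ, hcard, -⟩ := exists_hom_of_addOrderOf_sub_eq_two hgen h
  rw [hcard, mul_comm]
  refine mul_dvd_mul_left 2 ?_
  rw [← ZMod.natCast_eq_zero_iff]
  obtain ⟨x, hx⟩ := hπ 1
  rw [← nsmul_one, ← hx, ← map_nsmul, AddMonoid.exponent_nsmul_eq_zero, map_zero]

end CirculantIff

/-! ### Order, exponent and element orders of ℤⁿ/Mℤⁿ. -/

section Matrix

variable {n : ℕ}

theorem exists_eq_succAboveOrderEmb {k : ℕ} (f : Fin k ↪o Fin (k + 1)) :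
    ∃ j : Fin (k + 1), f = Fin.succAboveOrderEmb j := by
  classical
  have hcard : (Finset.univ.map f.toEmbedding)ᶜ.card = 1 := by
    rw [Finset.card_compl, Finset.card_map]
    simp
  obtain ⟨j, hj⟩ := Finset.card_eq_one.1 hcard
  refine ⟨j, ?_⟩
  rw [← Finset.orderEmbOfFin_compl_singleton_eq_succAboveOrderEmb]
  refine Finset.orderEmbOfFin_unique' _ fun x => ?_
  rw [← hj, compl_compl]
  simp

theorem Finset.dvd_mul_gcd_nat_iff {ι : Type*} {s : Finset ι} {f : ι → ℕ} {c k : ℕ} :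
    c ∣ k * s.gcd f ↔ ∀ i ∈ s, c ∣ k * f i := by
  rw [← (Finset.gcd_mul_left' (s := s) (f := f) k).dvd_iff_dvd_right, Finset.dvd_gcd_iff]

/-- Up to sign the entries of the adjugate are the minors of size n - 1, since an increasing choice
of n - 1 indices omits exactly one. The factor k serves to test multiples when computing the
exponent. -/
theorem dvd_mul_determinantalDivisor_pred_iff (hn : 1 ≤ n) (M : Matrix (Fin n) (Fin n) ℤ)
    (c k : ℕ) :
    c ∣ k * determinantalDivisor M (n - 1) ↔ ∀ i j, (c : ℤ) ∣ k * M.adjugate i j := by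
  obtain ⟨l, rfl⟩ : ∃ l, n = l + 1 := ⟨n - 1, by omega⟩
  rw [determinantalDivisor, Finset.dvd_mul_gcd_nat_iff]
  have hmul : ∀ x : ℤ, c ∣ k * x.natAbs ↔ (c : ℤ) ∣ k * x := fun x => by
    rw [Int.natCast_dvd, Int.natAbs_mul, Int.natAbs_natCast]
  have hsign : ∀ (i j : Fin (l + 1)) (x : ℤ),
      (c : ℤ) ∣ k * ((-1) ^ (j + i : ℕ) * x) ↔ (c : ℤ) ∣ k * x := fun i j x => by
    rw [mul_left_comm]
    exact (isUnit_neg_one.pow _).dvd_mul_left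
  simp only [Matrix.adjugate_fin_succ_eq_det_submatrix, Finset.mem_univ, true_imp_iff,
    Prod.forall, hmul, hsign]
  constructor
  · intro h i j
    exact h (Fin.succAboveOrderEmb j) (Fin.succAboveOrderEmb i)
  · intro h f g
    obtain ⟨j, rfl⟩ := exists_eq_succAboveOrderEmb f
    obtain ⟨i, rfl⟩ := exists_eq_succAboveOrderEmb g
    exact h i j

/-- Multiplying Mx = ka by the adjugate gives det(M) x = k adj(M) a. Conversely, multiply by M and
cancel the determinant. -/
theorem nsmul_mk_eq_zero_iff (M : Matrix (Fin n) (Fin n) ℤ) (hM : M.det ≠ 0) (a : Fin n → ℤ)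
    (k : ℕ) : k • VecMod.mk M a = 0 ↔ ∀ i, (M.det.natAbs : ℤ) ∣ k * scaledInv M a i := by
  have hs : M.det.sign * M.det.sign = 1 := by
    rcases lt_or_gt_of_ne hM with h | h
    · rw [Int.sign_eq_neg_one_of_neg h]; rfl
    · rw [Int.sign_eq_one_of_pos h]; rfl
  have habs : (M.det.natAbs : ℤ) = M.det.sign * M.det := (Int.sign_mul_self_eq_natAbs _).symm
  have hk : k • VecMod.mk M a = VecMod.mk M ((k : ℤ) • a) := by
    rw [natCast_zsmul]
    rfl
  rw [hk, Submodule.Quotient.mk_eq_zero, LinearMap.mem_range]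
  constructor
  · rintro ⟨x, hx⟩ i
    have h1 : M.det • x = (k : ℤ) • (M.adjugate *ᵥ a) := by
      rw [← Matrix.mulVec_smul, ← hx, Matrix.mulVecLin_apply, Matrix.mulVec_mulVec,
        Matrix.adjugate_mul, Matrix.smul_mulVec, Matrix.one_mulVec]
    have h2 := congrFun h1 i
    simp only [Pi.smul_apply, smul_eq_mul] at h2
    refine ⟨x i, ?_⟩
    simp only [scaledInv, Pi.smul_apply, smul_eq_mul]
    rw [habs]
    linear_combination (-M.det.sign) * h2
  · intro h
    choose x hx using h
    refine ⟨x, ?_⟩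
    have h1 : M.det • x = (k : ℤ) • (M.adjugate *ᵥ a) := by
      funext i
      have h2 := hx i
      simp only [scaledInv, Pi.smul_apply, smul_eq_mul, habs] at h2 ⊢
      linear_combination (-M.det.sign) * h2 + (M.det * x i - k * (M.adjugate *ᵥ a) i) * (-1) * hs
    have h2 : M.det • (M *ᵥ x) = M.det • ((k : ℤ) • a) := by
      rw [← Matrix.mulVec_smul, h1, Matrix.mulVec_smul, Matrix.mulVec_mulVec,
        Matrix.mul_adjugate, Matrix.smul_mulVec, Matrix.one_mulVec, smul_comm]
    exact smul_right_injective _ hM h2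

theorem card_vecMod (M : Matrix (Fin n) (Fin n) ℤ) (hM : M.det ≠ 0) :
    Nat.card (VecMod M) = M.det.natAbs := by
  have hinj : Function.Injective M.mulVecLin := by
    rw [Matrix.coe_mulVecLin]
    exact Matrix.mulVec_injective_of_det_ne_zero hM
  let e := LinearEquiv.ofInjective M.mulVecLin hinj
  rw [← Submodule.natAbs_det_equiv (matLattice M) e]
  have : (matLattice M).subtype ∘ₗ AddMonoidHom.toIntLinearMap (e : (Fin n → ℤ) →+ matLattice M) =
      M.mulVecLin := by
    ext x
    rfl
  rw [this, ← Matrix.toLin'_apply', LinearMap.det_toLin']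

/-- With g the gcd of m M⁻¹ a, a multiple k kills the class iff m ∣ kg, so its order is m / gcd(m,
g). -/
theorem addOrderOf_mk_eq_two_iff (M : Matrix (Fin n) (Fin n) ℤ) (hM : M.det ≠ 0)
    (a : Fin n → ℤ) :
    addOrderOf (VecMod.mk M a) = 2 ↔
      M.det.natAbs = 2 * Nat.gcd M.det.natAbs (vecGcd (scaledInv M a)) := by
  have hm : M.det.natAbs ≠ 0 := by simpa using hM
  have hk : ∀ k : ℕ, k • VecMod.mk M a = 0 ↔ M.det.natAbs ∣ k * vecGcd (scaledInv M a) := by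
    intro k
    rw [nsmul_mk_eq_zero_iff M hM, vecGcd, Finset.dvd_mul_gcd_nat_iff]
    simp only [Int.natCast_dvd, Int.natAbs_mul, Int.natAbs_natCast, Finset.mem_univ, true_imp_iff]
  have h1 := hk 1
  rw [one_smul, one_mul] at h1
  rw [addOrderOf_eq_prime_iff, hk, Ne, h1]
  generalize vecGcd (scaledInv M a) = g at *
  generalize M.det.natAbs = m at *
  have hd := Nat.gcd_dvd_left m g
  constructor
  · rintro ⟨h2, h3⟩
    have h4 : m ∣ 2 * Nat.gcd m g := by
      rw [← Nat.gcd_mul_left]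
      exact Nat.dvd_gcd (Dvd.intro_left 2 rfl) h2
    obtain ⟨c, hc⟩ := hd
    have hc0 : 0 < Nat.gcd m g := Nat.gcd_pos_of_pos_left _ (Nat.pos_of_ne_zero hm)
    have hc2 : c ∣ 2 := by
      rw [mul_comm 2] at h4
      nth_rw 1 [hc] at h4
      exact Nat.dvd_of_mul_dvd_mul_left hc0 h4
    rcases (Nat.dvd_prime Nat.prime_two).1 hc2 with rfl | rfl
    · rw [mul_one] at hc
      exact absurd (hc ▸ Nat.gcd_dvd_right m g) h3
    · rw [mul_comm]; exact hc
  · intro h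
    refine ⟨?_, fun h3 => ?_⟩
    · rw [h]
      exact mul_dvd_mul_left 2 (Nat.gcd_dvd_right _ _)
    · rw [Nat.gcd_eq_left h3] at h
      omega

/-- No Smith form is needed: k kills the group iff it kills the standard basis vectors, iff m
divides k times each adjugate entry, iff m ∣ k d_{n-1}(M). -/
theorem exponent_mul_determinantalDivisor (hn : 1 ≤ n) (M : Matrix (Fin n) (Fin n) ℤ)
    (hM : M.det ≠ 0) :
    AddMonoid.exponent (VecMod M) * determinantalDivisor M (n - 1) = M.det.natAbs := by
  have hexp : ∀ k, AddMonoid.exponent (VecMod M) ∣ k ↔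
      M.det.natAbs ∣ k * determinantalDivisor M (n - 1) := by
    intro k
    rw [AddMonoid.exponent_dvd_iff_forall_nsmul_eq_zero,
      dvd_mul_determinantalDivisor_pred_iff hn]
    have hs : IsUnit M.det.sign := by
      rw [Int.isUnit_iff]
      rcases lt_or_gt_of_ne hM with h | h
      · exact Or.inr (Int.sign_eq_neg_one_of_neg h)
      · exact Or.inl (Int.sign_eq_one_of_pos h)
    have hscaled : ∀ a i, (M.det.natAbs : ℤ) ∣ k * scaledInv M a i ↔
        (M.det.natAbs : ℤ) ∣ k * (M.adjugate *ᵥ a) i := by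
      intro a i
      rw [scaledInv, Pi.smul_apply, smul_eq_mul, mul_left_comm]
      exact hs.dvd_mul_left
    constructor
    · intro h i j
      have h1 := (nsmul_mk_eq_zero_iff M hM (Pi.single j 1) k).1 (h _) i
      rwa [hscaled, Matrix.mulVec_single_one] at h1
    · intro h x
      obtain ⟨a, rfl⟩ := Submodule.Quotient.mk_surjective _ x
      refine (nsmul_mk_eq_zero_iff M hM a k).2 fun i => ?_
      rw [hscaled, Matrix.mulVec, dotProduct, Finset.mul_sum]
      refine Finset.dvd_sum fun j _ => ?_
      rw [← mul_assoc]
      exact (h i j).mul_right _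
  have hdvd : determinantalDivisor M (n - 1) ∣ M.det.natAbs := by
    have h1 := (dvd_mul_determinantalDivisor_pred_iff hn M (determinantalDivisor M (n - 1)) 1).1
      (by rw [one_mul])
    simp only [Nat.cast_one, one_mul] at h1
    -- Laplace expansion along the first row shows d_{n-1}(M) ∣ m.
    have h2 : M.det = ∑ j, M ⟨0, hn⟩ j * M.adjugate j ⟨0, hn⟩ := by
      rw [← Matrix.mul_apply, Matrix.mul_adjugate]
      simp
    rw [← Int.natCast_dvd, h2]
    exact Finset.dvd_sum fun j _ => (h1 _ _).mul_left _
  obtain ⟨c, hc⟩ := hdvd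
  have hpos : 0 < determinantalDivisor M (n - 1) := by
    refine Nat.pos_of_ne_zero fun h => hM ?_
    rw [h, zero_mul] at hc
    exact Int.natAbs_eq_zero.1 hc
  have hexp' : ∀ k, AddMonoid.exponent (VecMod M) ∣ k ↔ c ∣ k := by
    intro k
    rw [hexp, hc, mul_comm k, Nat.mul_dvd_mul_iff_left hpos]
  rw [Nat.dvd_antisymm ((hexp' c).2 dvd_rfl) ((hexp' _).1 dvd_rfl), hc, mul_comm]

end Matrix

theorem theorem3p5 (n : ℕ) (hn : 1 ≤ n) (M : Matrix (Fin n) (Fin n) ℤ) (hM : M.det ≠ 0)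
    (m : ℕ) (hm : m = M.det.natAbs) (a₁ a₂ : Fin n → ℤ)
    (h₁ : VecMod.mk M a₁ ≠ 0) (h₂ : VecMod.mk M a₂ ≠ 0)
    (hgen : AddSubgroup.closure {VecMod.mk M a₁, VecMod.mk M a₂} = ⊤) :
    ((multiCirculantDigraph M {VecMod.mk M a₁, VecMod.mk M a₂}).IsCirculant ↔
      (determinantalDivisor M (n - 1) = 1 ∨
        (determinantalDivisor M (n - 1) = 2 ∧
          m = 2 * Nat.gcd m (vecGcd (scaledInv M (a₁ - a₂)))))) ∧
    ((multiCirculantGraph M {VecMod.mk M a₁, VecMod.mk M a₂}).IsCirculant ↔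
      (determinantalDivisor M (n - 1) = 1 ∨
        (determinantalDivisor M (n - 1) = 2 ∧
          m = 2 * Nat.gcd m (vecGcd (scaledInv M (a₁ - a₂)))) ∨
        (determinantalDivisor M (n - 1) = 2 ∧
          m = 2 * Nat.gcd m (vecGcd (scaledInv M (a₁ + a₂)))))) := by
  subst hm
  have hcard := card_vecMod M hM
  have hpos : 0 < M.det.natAbs := Int.natAbs_pos.2 hM
  have : Finite (VecMod M) := Nat.finite_of_card_ne_zero (hcard ▸ hpos.ne')
  have hexp := exponent_mul_determinantalDivisor hn M hM
  have hexp0 : 0 < AddMonoid.exponent (VecMod M) :=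
    Nat.pos_of_ne_zero fun h => by rw [h, zero_mul] at hexp; omega
  have hcyc : IsAddCyclic (VecMod M) ↔ determinantalDivisor M (n - 1) = 1 := by
    rw [IsAddCyclic.iff_exponent_eq_card, hcard, ← hexp]
    constructor
    · intro h
      exact Nat.eq_of_mul_eq_mul_left hexp0 (by rw [← h, mul_one])
    · intro h
      rw [h, mul_one]
  have htwo : ∀ x y : VecMod M, AddSubgroup.closure {x, y} = ⊤ → addOrderOf (x - y) = 2 →
      determinantalDivisor M (n - 1) = 1 ∨ determinantalDivisor M (n - 1) = 2 := by
    intro x y hxy h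
    have h1 := card_dvd_two_mul_exponent hxy h
    rw [hcard, ← hexp, mul_comm 2] at h1
    exact (Nat.dvd_prime Nat.prime_two).1 (Nat.dvd_of_mul_dvd_mul_left hexp0 h1)
  have hsub := htwo _ _ hgen
  have hadd := htwo _ _ ((closure_pair_neg_right _ _).trans hgen)
  rw [sub_neg_eq_add] at hadd
  rw [multiCirculantDigraph, multiCirculantGraph, cayleyDigraph_pair_isCirculant_iff h₁ h₂ hgen,
    circulantGraph_pair_isCirculant_iff_addOrderOf h₁ h₂ hgen, hcyc,
    ← addOrderOf_mk_eq_two_iff M hM, ← addOrderOf_mk_eq_two_iff M hM]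
  rw [show VecMod.mk M (a₁ - a₂) = VecMod.mk M a₁ - VecMod.mk M a₂ from rfl,
    show VecMod.mk M (a₁ + a₂) = VecMod.mk M a₁ + VecMod.mk M a₂ from rfl]
  -- An element a₁ ± a₂ of order 2 already forces d_{n-1}(M) to be 1 or 2, so requiring it to be 2
  -- only removes an overlap with (a).
  have hiff : ∀ {A D X : Prop}, (X → A ∨ D) → (A ∨ X ↔ A ∨ D ∧ X) := by
    clear * -
    tauto
  have hiff' : ∀ {A D X Y : Prop}, (X → A ∨ D) → (Y → A ∨ D) →
      (A ∨ X ∨ Y ↔ A ∨ D ∧ X ∨ D ∧ Y) := by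
    clear * -
    tauto
  exact ⟨hiff hsub, hiff' hsub hadd⟩
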